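/- Let $A\in\mathbb{C}^{N\times N}$. For delays $m=(m_1,\dots,m_N)$ with integers $m_i\ge 1$ put $p_{A,m}(z)=\det\left(\operatorname{diag}(z^{m_1},\dots,z^{m_N})-A\right)$. Call $A$ unilossless if, for every choice of $m$, all complex roots of $p_{A,m}$ have modulus $1$. Call $A$ reducible if there is a permutation matrix $P$ with $P^{-1}AP=\begin{bmatrix}E&G\\0&F\end{bmatrix}$, where $E$ and $F$ are square of positive size, and irreducible otherwise. The irreducible components of $A$ are the diagonal blocks of a block upper triangular form of $A$, obtained by a simultaneous permutation of rows and columns, all of whose diagonal blocks are irreducible. Then $A$ is unilossless if and only if at least one of the following holds: 1. $A$ is reducible and all its irreducible components are unilossless; 2. there is a diagonal matrix $E$ with positive diagonal entries such that $A E A^{\mathsf H}=E$. Moreover, condition 2 holds if and only if $A$ is diagonally similar to a unitary matrix, that is, there is a nonsingular diagonal matrix $F$ such that $F^{-1}AF$ is unitary. -/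

import Mathlib

namespace FDN

open Polynomial

/-- The generalized characteristic polynomial `det (diag (z ^ m i) - A)` of a feedback matrix `A`
with delays `m`. -/
noncomputable def genCharpoly {ι : Type*} [Fintype ι] [DecidableEq ι]
    (A : Matrix ι ι ℂ) (m : ι → ℕ) : ℂ[X] :=
  (Matrix.diagonal (fun i => (X : ℂ[X]) ^ m i) - A.map C).det

/-- A polynomial is lossless if all its complex roots are unimodular. -/
def IsLossless (p : ℂ[X]) : Prop :=
  ∀ z : ℂ, p.IsRoot z → ‖z‖ = 1

/-- `A` is unilossless if its generalized characteristic polynomial is lossless for every choice of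
positive integer delays. -/
def IsUnilossless {ι : Type*} [Fintype ι] [DecidableEq ι] (A : Matrix ι ι ℂ) : Prop :=
  ∀ m : ι → ℕ, (∀ i, 1 ≤ m i) → IsLossless (genCharpoly A m)

/-- `A` is reducible if some simultaneous permutation of its rows and columns brings it to the form
`[E G; 0 F]` with `E` and `F` square and of positive size. -/
def IsReducible {ι : Type*} (A : Matrix ι ι ℂ) : Prop :=
  ∃ (p q : ℕ) (σ : Fin p ⊕ Fin q ≃ ι) (E : Matrix (Fin p) (Fin p) ℂ)
    (G : Matrix (Fin p) (Fin q) ℂ) (F : Matrix (Fin q) (Fin q) ℂ),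
    0 < p ∧ 0 < q ∧ A.submatrix σ σ = Matrix.fromBlocks E G 0 F

/-- `b` sorts the indices into `k` nonempty blocks (listed in order) for which `A` becomes block
upper triangular with irreducible diagonal blocks. -/
structure IsIrreducibleBlockForm {ι : Type*} (A : Matrix ι ι ℂ) {k : ℕ} (b : ι → Fin k) :
    Prop where
  surjective : Function.Surjective b
  blockTriangular : A.BlockTriangular b
  irreducible : ∀ c : Fin k, ¬ IsReducible (A.toSquareBlock b c)

/-- All irreducible components of `A`, that is, all diagonal blocks of its block triangular forms
with irreducible diagonal blocks, are unilossless. -/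
def AllComponentsUnilossless {ι : Type*} [Fintype ι] [DecidableEq ι] (A : Matrix ι ι ℂ) : Prop :=
  ∀ (k : ℕ) (b : ι → Fin k), IsIrreducibleBlockForm A b →
    ∀ c : Fin k, IsUnilossless (A.toSquareBlock b c)

/-- There is a diagonal matrix `E` with positive diagonal entries such that `A E Aᴴ = E`. -/
def HasPositiveDiagonalInvariant {ι : Type*} [Fintype ι] [DecidableEq ι]
    (A : Matrix ι ι ℂ) : Prop :=
  ∃ e : ι → ℝ, (∀ i, 0 < e i) ∧
    A * Matrix.diagonal (fun i => (e i : ℂ)) * A.conjTranspose =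
      Matrix.diagonal (fun i => (e i : ℂ))

/-- `A` is similar to a unitary matrix through a nonsingular complex diagonal matrix. -/
def IsDiagonallySimilarToUnitary {ι : Type*} [Fintype ι] [DecidableEq ι]
    (A : Matrix ι ι ℂ) : Prop :=
  ∃ f : ι → ℂ, (∀ i, f i ≠ 0) ∧
    (Matrix.diagonal f)⁻¹ * A * Matrix.diagonal f ∈ Matrix.unitaryGroup ι ℂ

end FDN

/-! A positive invariant matrix `E` turns a left null vector `v` of `diag (z ^ m i) - A` into the
identity `∑ i, E i * |v i| ^ 2 * |z| ^ (2 * m i) = ∑ i, E i * |v i| ^ 2`, which forces `|z| = 1`.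

Conversely, let `A` be unilossless. As the delays vary, the powers `(ρ ζ) ^ m k` approximate any
prescribed values of modulus at least `1`, so `det (W - A)` inherits, as a function of the diagonal
matrix `W`, the self-inversiveness and the radial growth of polynomials with unimodular roots.
Relative to a fixed unitary `W` these properties say that the polynomial `det (1 + (D - 1) T)`,
with `T = W (W - A)⁻¹`, is lossless, and they pass to the principal submatrices of `T`. Blocks of
size one give `Re (T k k) = 1 / 2`, blocks of size two give `0 ≤ -(T i j * T j i)`. Rotating one
entry of `W` adds a multiple of the rank-one matrix `(T - 1) e_k e_kᴴ T` to `T`; as the last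
inequality persists, a quadratic polynomial in the rotation parameter is nonnegative, and this
relates the products of `T` along the two orientations of a 3-cycle. If `A` is irreducible, a `T`
of maximal support has no zero entry, and the relations produce a positive diagonal `E` with
`T E + E Tᴴ = E`, which is `A E Aᴴ = E` rewritten. For reducible `A`, the polynomial is the product
of those of the diagonal blocks.
-/

namespace FDN

open Polynomial Matrix Filter Topology
open scoped ComplexOrder ComplexConjugate

variable {ι : Type*} [Fintype ι] [DecidableEq ι]

/-! ### Polynomials with unimodular roots -/

theorem sub_eq_mul_conj_sub {z a : ℂ} (hz : ‖z‖ = 1) (ha : ‖a‖ = 1) :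
    z - a = (0 - a) * z * conj (z - a) := by
  have hzz : z * conj z = 1 := by simp [Complex.mul_conj', hz]
  have haa : a * conj a = 1 := by simp [Complex.mul_conj', ha]
  rw [map_sub]
  linear_combination a * hzz - z * haa

theorem mul_norm_sub_sq_le {z a : ℂ} (hz : ‖z‖ = 1) (ha : ‖a‖ = 1) {r : ℝ} (hr : 0 ≤ r) :
    r * ‖z - a‖ ^ 2 ≤ ‖(r : ℂ) * z - a‖ ^ 2 := by
  have hz2 : ‖z‖ ^ 2 = 1 := by simp [hz]
  have ha2 : ‖a‖ ^ 2 = 1 := by simp [ha]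
  simp only [← Complex.normSq_eq_norm_sq, Complex.normSq_apply, Complex.sub_re, Complex.sub_im,
    Complex.re_ofReal_mul, Complex.im_ofReal_mul] at *
  nlinarith [sq_nonneg (r - 1)]

theorem IsLossless.eval_eq_conj {p : ℂ[X]} {n : ℕ} (h : IsLossless p) (hp : IsMonicOfDegree p n)
    {z : ℂ} (hz : ‖z‖ = 1) : p.eval z = p.eval 0 * z ^ n * conj (p.eval z) := by
  have hsplit := IsAlgClosed.splits p
  have hpow : z ^ n = (p.roots.map fun _ => z).prod := by
    simp [← hp.natDegree_eq, hsplit.natDegree_eq_card_roots]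
  simp only [hsplit.eval_eq_prod_roots_of_monic hp.monic, hpow, map_multiset_prod,
    Multiset.map_map, ← Multiset.prod_map_mul]
  exact congrArg _ <| Multiset.map_congr rfl fun a ha =>
    sub_eq_mul_conj_sub hz (h a (isRoot_of_mem_roots ha))

theorem IsLossless.pow_mul_norm_eval_sq_le {p : ℂ[X]} {n : ℕ} (h : IsLossless p)
    (hp : IsMonicOfDegree p n) {z : ℂ} (hz : ‖z‖ = 1) {r : ℝ} (hr : 0 ≤ r) :
    r ^ n * ‖p.eval z‖ ^ 2 ≤ ‖p.eval ((r : ℂ) * z)‖ ^ 2 := by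
  have hsplit := IsAlgClosed.splits p
  have hpow : r ^ n = (p.roots.map fun _ => r).prod := by
    simp [← hp.natDegree_eq, hsplit.natDegree_eq_card_roots]
  have hnorm : ∀ x, ‖p.eval x‖ ^ 2 = (p.roots.map fun a => ‖x - a‖ ^ 2).prod := fun x => by
    rw [hsplit.eval_eq_prod_roots_of_monic hp.monic, Multiset.prod_map_pow]
    congr 1
    exact (map_multiset_prod (normHom : ℂ →*₀ ℝ) _).trans (by rw [Multiset.map_map]; rfl)
  rw [hpow, hnorm, hnorm, ← Multiset.prod_map_mul]
  exact Multiset.prod_map_le_prod_map₀ _ _ (fun a _ => by positivity) fun a ha =>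
    mul_norm_sub_sq_le hz (h a (isRoot_of_mem_roots ha)) hr

theorem isMonicOfDegree_det {R : Type*} [CommRing R] [Nontrivial R] {M : Matrix ι ι R[X]}
    {m : ι → ℕ} (hdiag : ∀ i, IsMonicOfDegree (M i i) (m i))
    (hoff : ∀ i j, i ≠ j → (M i j).natDegree < m j) : IsMonicOfDegree M.det (∑ i, m i) := by
  have hle : ∀ i j, (M i j).natDegree ≤ m j := fun i j => by
    rcases eq_or_ne i j with rfl | hij
    · exact (hdiag i).natDegree_eq.le
    · exact (hoff i j hij).le
  have hterm_le : ∀ σ : Equiv.Perm ι, (∏ i, M (σ i) i).natDegree ≤ ∑ i, m i := fun σ =>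
    (natDegree_prod_le _ _).trans (Finset.sum_le_sum fun i _ => hle _ _)
  have hterm_lt : ∀ σ : Equiv.Perm ι, σ ≠ 1 → (∏ i, M (σ i) i).natDegree < ∑ i, m i := by
    intro σ hσ
    obtain ⟨k, hk⟩ : ∃ k, σ k ≠ k := by
      by_contra! h
      exact hσ (Equiv.ext h)
    exact (natDegree_prod_le _ _).trans_lt <|
      Finset.sum_lt_sum (fun i _ => hle _ _) ⟨k, Finset.mem_univ k, hoff _ _ hk⟩
  rw [isMonicOfDegree_iff, det_apply]
  refine ⟨natDegree_sum_le_of_forall_le _ _ fun σ _ =>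
    (natDegree_smul_le _ _).trans (hterm_le σ), ?_⟩
  rw [finsetSum_coeff, Finset.sum_eq_single 1 _ (by simp)]
  · have hprod : (∏ i, M i i).natDegree = ∑ i, m i := by
      rw [natDegree_prod_of_monic _ _ fun i _ => (hdiag i).monic]
      exact Finset.sum_congr rfl fun i _ => (hdiag i).natDegree_eq
    simpa [← hprod] using (monic_prod_of_monic _ _ fun i _ => (hdiag i).monic).leadingCoeff
  · intro σ _ hσ
    rw [coeff_smul, coeff_eq_zero_of_natDegree_lt (hterm_lt σ hσ), smul_zero]

theorem isMonicOfDegree_genCharpoly (A : Matrix ι ι ℂ) {m : ι → ℕ} (hm : ∀ i, 1 ≤ m i) :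
    IsMonicOfDegree (genCharpoly A m) (∑ i, m i) := by
  refine isMonicOfDegree_det (fun i => ?_) fun i j hij => ?_
  · simpa using (isMonicOfDegree_X_pow ℂ (m i)).sub ((natDegree_C (A i i)).trans_lt (hm i))
  · simpa [hij] using Nat.lt_of_succ_le (hm j)

theorem eval_genCharpoly (A : Matrix ι ι ℂ) (m : ι → ℕ) (z : ℂ) :
    (genCharpoly A m).eval z = (diagonal (fun i => z ^ m i) - A).det := by
  rw [genCharpoly, ← coe_evalRingHom, RingHom.map_det]
  congr 1
  ext i j
  rcases eq_or_ne i j with rfl | hij <;> simp [*]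

theorem exists_exp_two_pi_mul_I_eq {u : ℂ} (hu : ‖u‖ = 1) :
    ∃ θ : ℝ, 0 ≤ θ ∧ Complex.exp (2 * Real.pi * Complex.I * θ) = u := by
  refine ⟨u.arg / (2 * Real.pi) + 1, ?_, ?_⟩
  · have := Complex.neg_pi_lt_arg u
    rw [← neg_le_iff_add_nonneg, le_div_iff₀ Real.two_pi_pos]
    linarith [Real.pi_pos]
  · have hpi : (Real.pi : ℂ) ≠ 0 := by exact_mod_cast Real.pi_ne_zero
    have hexp : 2 * Real.pi * Complex.I * ((u.arg / (2 * Real.pi) + 1 : ℝ) : ℂ) =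
        u.arg * Complex.I + 2 * Real.pi * Complex.I := by
      push_cast
      field_simp
    rw [hexp, Complex.exp_periodic]
    simpa [hu] using Complex.norm_mul_exp_arg_mul_I u

theorem tendsto_natFloor_mul_natCast_div {a : ℝ} (ha : 0 ≤ a) :
    Tendsto (fun n : ℕ => (⌊a * n⌋₊ : ℝ) / n) atTop (𝓝 a) :=
  (tendsto_nat_floor_mul_div_atTop ha).comp tendsto_natCast_atTop_atTop

theorem tendsto_exp_inv_sq_pow {a θ : ℝ} (ha : 0 ≤ a) (hθ : 0 ≤ θ) :
    Tendsto (fun n : ℕ => Real.exp (((n : ℝ) ^ 2)⁻¹) ^ (n * ⌊a * n⌋₊ + ⌊θ * n⌋₊ + 1)) atTop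
      (𝓝 (Real.exp a)) := by
  have hinv : Tendsto (fun n : ℕ => ((n : ℝ))⁻¹) atTop (𝓝 0) := tendsto_inv_atTop_nhds_zero_nat
  have hlim := (tendsto_natFloor_mul_natCast_div ha).add
    (((tendsto_natFloor_mul_natCast_div hθ).mul hinv).add (hinv.mul hinv))
  rw [mul_zero, mul_zero, add_zero, add_zero] at hlim
  refine ((Real.continuous_exp.tendsto _).comp hlim).congr' ?_
  filter_upwards [eventually_ne_atTop 0] with n hn
  rw [← Real.exp_nat_mul]
  push_cast
  simp only [Function.comp_apply]
  congr 1
  field_simp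
  ring

theorem tendsto_exp_two_pi_mul_I_div_pow {θ : ℝ} (hθ : 0 ≤ θ) (a : ℕ → ℕ) :
    Tendsto (fun n : ℕ => Complex.exp (2 * Real.pi * Complex.I / n) ^ (n * a n + ⌊θ * n⌋₊ + 1))
      atTop (𝓝 (Complex.exp (2 * Real.pi * Complex.I * θ))) := by
  have hlim := (tendsto_natFloor_mul_natCast_div hθ).add tendsto_inv_atTop_nhds_zero_nat
  rw [add_zero] at hlim
  have hcont : Continuous fun t : ℝ => Complex.exp (2 * Real.pi * Complex.I * t) := by
    fun_prop
  refine ((hcont.tendsto _).comp hlim).congr' ?_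
  filter_upwards [eventually_ne_atTop 0] with n hn
  have hn' : (n : ℂ) ≠ 0 := Nat.cast_ne_zero.mpr hn
  have hroot : Complex.exp (2 * Real.pi * Complex.I / n) ^ n = 1 := by
    rw [← Complex.exp_nat_mul, mul_div_cancel₀ _ hn', Complex.exp_two_pi_mul_I]
  rw [add_assoc, pow_add, pow_mul, hroot, one_pow, one_mul, ← Complex.exp_nat_mul]
  simp only [Function.comp_apply]
  congr 1
  push_cast
  field_simp

theorem exists_tendsto_pow {κ : Type*} {x : κ → ℝ} (hx : ∀ k, 1 ≤ x k) {u : κ → ℂ}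
    (hu : ∀ k, ‖u k‖ = 1) :
    ∃ (ρ : ℕ → ℝ) (ζ : ℕ → ℂ) (m : ℕ → κ → ℕ),
      (∀ n, 0 ≤ ρ n) ∧ (∀ n, ‖ζ n‖ = 1) ∧ (∀ n k, 1 ≤ m n k) ∧
      (∀ k, Tendsto (fun n => ρ n ^ m n k) atTop (𝓝 (x k))) ∧
      ∀ k, Tendsto (fun n => ζ n ^ m n k) atTop (𝓝 (u k)) := by
  choose θ hθ hθu using fun k => exists_exp_two_pi_mul_I_eq (hu k)
  -- Multiples of `n` in the exponent are invisible to `exp (2πi / n)`, while `⌊θ k * n⌋` is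
  -- negligible for `exp (1 / n ^ 2)`; so modulus and argument are approximated independently.
  refine ⟨fun n => Real.exp (((n : ℝ) ^ 2)⁻¹), fun n => Complex.exp (2 * Real.pi * Complex.I / n),
    fun n k => n * ⌊Real.log (x k) * n⌋₊ + ⌊θ k * n⌋₊ + 1, fun n => (Real.exp_pos _).le,
    fun n => by simp [Complex.norm_exp], fun n k => Nat.le_add_left _ _, fun k => ?_, fun k => ?_⟩
  · have h := tendsto_exp_inv_sq_pow (Real.log_nonneg (hx k)) (hθ k)
    rwa [Real.exp_log (zero_lt_one.trans_le (hx k))] at h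
  · have h := tendsto_exp_two_pi_mul_I_div_pow (hθ k) fun n => ⌊Real.log (x k) * n⌋₊
    rwa [hθu] at h

theorem continuous_det_diagonal_sub (A : Matrix ι ι ℂ) :
    Continuous fun w : ι → ℂ => (diagonal w - A).det := by
  fun_prop

theorem IsUnilossless.det_eq_conj {A : Matrix ι ι ℂ} (hA : IsUnilossless A) {w : ι → ℂ}
    (hw : ∀ k, ‖w k‖ = 1) :
    (diagonal w - A).det = (-A).det * (∏ k, w k) * conj (diagonal w - A).det := by
  obtain ⟨-, ζ, m, -, hζ, hm, -, hlim⟩ := exists_tendsto_pow (fun _ => le_rfl) hw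
  have hpow : Tendsto (fun n k => ζ n ^ m n k) atTop (𝓝 w) := tendsto_pi_nhds.mpr hlim
  have hdet := ((continuous_det_diagonal_sub A).tendsto w).comp hpow
  have hprod : Tendsto (fun n => ∏ k, ζ n ^ m n k) atTop (𝓝 (∏ k, w k)) :=
    tendsto_finsetProd _ fun k _ => hlim k
  refine tendsto_nhds_unique hdet <| ((tendsto_const_nhds.mul hprod).mul
    ((Complex.continuous_conj.tendsto _).comp hdet)).congr fun n => ?_
  have h0 : (genCharpoly A (m n)).eval 0 = (-A).det := by
    rw [eval_genCharpoly]
    congr 1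
    ext i j
    simp [diagonal, zero_pow (Nat.one_le_iff_ne_zero.mp (hm n _))]
  have h := (hA _ (hm n)).eval_eq_conj (isMonicOfDegree_genCharpoly A (hm n)) (hζ n)
  rw [h0, eval_genCharpoly, ← Finset.prod_pow_eq_pow_sum] at h
  exact h.symm

theorem IsUnilossless.prod_mul_norm_det_sq_le {A : Matrix ι ι ℂ} (hA : IsUnilossless A) {w : ι → ℂ}
    (hw : ∀ k, ‖w k‖ = 1) {x : ι → ℝ} (hx : ∀ k, 1 ≤ x k) :
    (∏ k, x k) * ‖(diagonal w - A).det‖ ^ 2 ≤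
      ‖(diagonal (fun k => (x k : ℂ) * w k) - A).det‖ ^ 2 := by
  obtain ⟨ρ, ζ, m, hρ, hζ, hm, hlimρ, hlimζ⟩ := exists_tendsto_pow hx hw
  have hcont := continuous_det_diagonal_sub A
  have hw_lim := (hcont.tendsto w).comp (tendsto_pi_nhds.mpr hlimζ)
  have hxw_lim := (hcont.tendsto fun k => (x k : ℂ) * w k).comp <| tendsto_pi_nhds.mpr fun k =>
    ((Complex.continuous_ofReal.tendsto _).comp (hlimρ k)).mul (hlimζ k)
  refine le_of_tendsto_of_tendsto' ((tendsto_finsetProd _ fun k _ => hlimρ k).mul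
    (hw_lim.norm.pow 2)) (hxw_lim.norm.pow 2) fun n => ?_
  have h := (hA _ (hm n)).pow_mul_norm_eval_sq_le (isMonicOfDegree_genCharpoly A (hm n))
    (hζ n) (hρ n)
  simpa only [eval_genCharpoly, ← Finset.prod_pow_eq_pow_sum, Function.comp_def, mul_pow,
    Complex.ofReal_pow] using h

/-! ### Scaled resolvents -/

/-- The scaled resolvents `W (W - A)⁻¹` of `A` at the diagonal unitary matrices `W` for which
`W - A` is invertible. The equation `T (W - A) = W` encodes both the value and the
invertibility. -/
def torusResolvents (A : Matrix ι ι ℂ) : Set (Matrix ι ι ℂ) :=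
  {T | ∃ w : ι → ℂ, (∀ k, ‖w k‖ = 1) ∧ T * (diagonal w - A) = diagonal w}

/-- The polynomial `det (1 + (D - 1) T)` in the entries `d` of `D`. For `T = W (W - A)⁻¹` it is
the factor by which `det (W - A)` changes when `W` is replaced by `D W`. -/
noncomputable def perturbationDet (T : Matrix ι ι ℂ) (d : ι → ℂ) : ℂ :=
  (1 + diagonal (d - 1) * T).det

/-- The two properties which `perturbationDet T` inherits, for a scaled resolvent `T` of a
unilossless matrix, from polynomials all of whose roots are unimodular: self-inversiveness on the
torus and growth in the radial directions. -/
structure IsLosslessResolvent (T : Matrix ι ι ℂ) : Prop where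
  eq_conj : ∀ d : ι → ℂ, (∀ k, ‖d k‖ = 1) →
    perturbationDet T d = (∏ k, d k) * conj (perturbationDet T d)
  prod_mul_norm_sq_le : ∀ d : ι → ℂ, (∀ k, ‖d k‖ = 1) → ∀ x : ι → ℝ, (∀ k, 1 ≤ x k) →
    (∏ k, x k) * ‖perturbationDet T d‖ ^ 2 ≤ ‖perturbationDet T fun k => x k * d k‖ ^ 2

theorem det_diagonal_ne_zero {w : ι → ℂ} (hw : ∀ k, ‖w k‖ = 1) : (diagonal w).det ≠ 0 := by
  rw [det_diagonal]
  exact Finset.prod_ne_zero_iff.mpr fun k _ => norm_ne_zero_iff.mp (by simp [hw])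

theorem det_diagonal_mul_sub {A T : Matrix ι ι ℂ} {w : ι → ℂ}
    (hT : T * (diagonal w - A) = diagonal w) (d : ι → ℂ) :
    (diagonal (fun k => d k * w k) - A).det = perturbationDet T d * (diagonal w - A).det := by
  have hdiag : diagonal (fun k => d k * w k) = diagonal w + diagonal (d - 1) * diagonal w := by
    rw [diagonal_mul_diagonal, diagonal_add]
    congr 1
    funext k
    simp only [Pi.sub_apply, Pi.one_apply]
    ring
  rw [perturbationDet, ← det_mul, add_mul, one_mul, mul_assoc, hT, hdiag]
  congr 1
  abel

theorem det_diagonal_sub_ne_zero {A T : Matrix ι ι ℂ} {w : ι → ℂ} (hw : ∀ k, ‖w k‖ = 1)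
    (hT : T * (diagonal w - A) = diagonal w) : (diagonal w - A).det ≠ 0 := by
  have h := det_diagonal_ne_zero hw
  rw [← hT, det_mul] at h
  exact right_ne_zero_of_mul h

theorem isUnit_of_mem_torusResolvents {A T : Matrix ι ι ℂ} (hT : T ∈ torusResolvents A) :
    IsUnit T := by
  obtain ⟨w, hw, hT⟩ := hT
  have h := det_diagonal_ne_zero hw
  rw [← hT, det_mul] at h
  exact (isUnit_iff_isUnit_det T).mpr (left_ne_zero_of_mul h).isUnit

theorem diagonal_mul_inv_mem_torusResolvents {A : Matrix ι ι ℂ} {w : ι → ℂ}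
    (hw : ∀ k, ‖w k‖ = 1) (hdet : (diagonal w - A).det ≠ 0) :
    diagonal w * (diagonal w - A)⁻¹ ∈ torusResolvents A :=
  ⟨w, hw, nonsing_inv_mul_cancel_right _ _ hdet.isUnit⟩

theorem IsUnilossless.isLosslessResolvent {A T : Matrix ι ι ℂ} (hA : IsUnilossless A)
    (hT : T ∈ torusResolvents A) : IsLosslessResolvent T := by
  obtain ⟨w, hw, hT⟩ := hT
  have hdet := det_diagonal_sub_ne_zero hw hT
  refine ⟨fun d hd => ?_, fun d hd x hx => ?_⟩
  · have h := hA.det_eq_conj (w := fun k => d k * w k) fun k => by simp [hd, hw]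
    rw [det_diagonal_mul_sub hT, map_mul, Finset.prod_mul_distrib] at h
    refine mul_right_cancel₀ hdet ?_
    linear_combination h -
      (∏ k, d k) * conj (perturbationDet T d) * hA.det_eq_conj hw
  · have h := hA.prod_mul_norm_det_sq_le (w := fun k => d k * w k) (fun k => by simp [hd, hw]) hx
    simp only [← mul_assoc (_ : ℂ)] at h
    rw [det_diagonal_mul_sub hT, det_diagonal_mul_sub hT, norm_mul, norm_mul, mul_pow, mul_pow,
      ← mul_assoc] at h
    exact le_of_mul_le_mul_right h (by positivity)

theorem det_one_add_diagonal_extend_mul {R κ : Type*} [CommRing R] [Fintype κ] [DecidableEq κ]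
    {e : κ → ι} (he : Function.Injective e) (v : κ → R) (M : Matrix ι ι R) :
    (1 + diagonal (Function.extend e v 0) * M).det = (1 + diagonal v * M.submatrix e e).det := by
  let U : Matrix ι κ R := (1 : Matrix ι ι R).submatrix id e
  have hU : diagonal (Function.extend e v 0) = U * diagonal v * Uᵀ := by
    ext i j
    rw [mul_apply]
    by_cases hi : ∃ k, e k = i
    · obtain ⟨k, rfl⟩ := hi
      rw [Finset.sum_eq_single k (fun l _ hl => by simp [U, one_apply, he.eq_iff, hl.symm])
        (by simp)]
      simp [U, one_apply, he.extend_apply, diagonal_apply, @eq_comm _ j]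
    · have hik : ∀ k, i ≠ e k := fun k hk => hi ⟨k, hk.symm⟩
      simp [U, one_apply, hik, Function.extend_apply' v (0 : ι → R) i hi, diagonal_apply]
  have hM : M.submatrix e e = Uᵀ * M * U := by
    ext i j
    simp [U, mul_apply, one_apply]
  rw [hU, hM, Matrix.mul_assoc _ Uᵀ M, Matrix.mul_assoc U, det_one_add_mul_comm U,
    Matrix.mul_assoc (diagonal v)]

theorem perturbationDet_submatrix {κ : Type*} [Fintype κ] [DecidableEq κ] (T : Matrix ι ι ℂ)
    {e : κ → ι} (he : Function.Injective e) (d : κ → ℂ) :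
    perturbationDet (T.submatrix e e) d = perturbationDet T (Function.extend e d 1) := by
  have hextend : Function.extend e d 1 - 1 = Function.extend e (d - 1) (0 : ι → ℂ) := by
    funext i
    by_cases hi : ∃ k, e k = i
    · obtain ⟨k, rfl⟩ := hi
      simp [he.extend_apply]
    · simp [Function.extend_apply' _ _ _ hi]
  rw [perturbationDet, perturbationDet, hextend, det_one_add_diagonal_extend_mul he]

theorem forall_extend_one {α β R : Type*} [One R] {P : R → Prop} {d : α → R} (h1 : P 1)
    (hd : ∀ k, P (d k)) {e : α → β} (he : Function.Injective e) (i : β) :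
    P (Function.extend e d 1 i) := by
  by_cases hi : ∃ k, e k = i
  · obtain ⟨k, rfl⟩ := hi
    rw [he.extend_apply]
    exact hd k
  · rwa [Function.extend_apply' _ _ _ hi]

theorem prod_extend_one {α β R : Type*} [Fintype α] [Fintype β] [CommMonoid R] (d : α → R)
    {e : α → β} (he : Function.Injective e) : ∏ i, Function.extend e d 1 i = ∏ k, d k :=
  (Fintype.prod_of_injective e he _ _ (fun i hi => Function.extend_apply' d (1 : β → R) i hi)
    fun _ => (he.extend_apply _ _ _).symm).symm

theorem IsLosslessResolvent.submatrix {κ : Type*} [Fintype κ] [DecidableEq κ]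
    {T : Matrix ι ι ℂ} (hT : IsLosslessResolvent T) {e : κ → ι} (he : Function.Injective e) :
    IsLosslessResolvent (T.submatrix e e) := by
  refine ⟨fun d hd => ?_, fun d hd x hx => ?_⟩
  · rw [perturbationDet_submatrix T he, ← prod_extend_one d he]
    exact hT.eq_conj _ (forall_extend_one (P := (‖·‖ = 1)) norm_one hd he)
  · have hmul : Function.extend e (fun k => (x k : ℂ) * d k) 1 =
        fun i => ((Function.extend e x 1 i : ℝ) : ℂ) * Function.extend e d 1 i := by
      funext i
      by_cases hi : ∃ k, e k = i
      · obtain ⟨k, rfl⟩ := hi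
        simp [he.extend_apply]
      · simp [Function.extend_apply' _ _ _ hi]
    rw [perturbationDet_submatrix T he, perturbationDet_submatrix T he, ← prod_extend_one x he,
      hmul]
    exact hT.prod_mul_norm_sq_le _ (forall_extend_one (P := (‖·‖ = 1)) norm_one hd he) _
      (forall_extend_one (P := ((1 : ℝ) ≤ ·)) le_rfl hx he)

theorem perturbationDet_fin_one (T : Matrix (Fin 1) (Fin 1) ℂ) (u : ℂ) :
    perturbationDet T ![u] = 1 + (u - 1) * T 0 0 := by
  simp [perturbationDet, diagonal_mul, vecHead]

theorem perturbationDet_fin_two (T : Matrix (Fin 2) (Fin 2) ℂ) (u v : ℂ) :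
    perturbationDet T ![u, v] =
      T.det * (u * v) + (T 0 0 - T.det) * u + (T 1 1 - T.det) * v +
        (1 - T 0 0 - T 1 1 + T.det) := by
  simp only [perturbationDet, det_fin_two, Matrix.add_apply, diagonal_mul, one_apply]
  simp only [↓reduceIte, Fin.isValue, Pi.sub_apply, cons_val_zero, Pi.one_apply, cons_val_one,
    cons_val_fin_one, zero_ne_one, zero_add, one_ne_zero]
  ring

theorem IsLosslessResolvent.apply_add_conj {T : Matrix ι ι ℂ} (hT : IsLosslessResolvent T)
    (k : ι) : T k k + conj (T k k) = 1 := by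
  have h := (hT.submatrix (e := ![k]) (Function.injective_of_subsingleton _)).eq_conj ![-1]
    (by simp)
  rw [perturbationDet_fin_one] at h
  simp only [submatrix_apply, cons_val_fin_one, Finset.univ_unique, Finset.prod_const,
    Finset.card_singleton, pow_one, map_add, map_one, map_mul, map_sub, map_neg] at h
  linear_combination -h / 2

/-! ### Signs of opposite entries -/

theorem exists_biaffine_eq_norm {a b : ℂ} (ha : a ≠ 0) (hb : b ≠ 0) :
    ∃ η u v : ℂ, ‖η‖ = 1 ∧ ‖u‖ = 1 ∧ ‖v‖ = 1 ∧ ∀ s t : ℂ,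
      a * (s * u * (t * v)) + b * (s * u) + conj b * (t * v) + conj a =
        η * (‖a‖ * (s * t) - ‖b‖ * (s + t) + ‖a‖) := by
  have hα : (‖a‖ : ℂ) ≠ 0 := by simpa using ha
  have hβ : (‖b‖ : ℂ) ≠ 0 := by simpa using hb
  obtain ⟨η, hη⟩ : ∃ η, conj a = ‖a‖ * η := ⟨conj a / ‖a‖, by field_simp⟩
  have hη_norm : ‖η‖ = 1 := by
    have h := congrArg norm hη
    rwa [RCLike.norm_conj, norm_mul, Complex.norm_real, norm_norm,
      left_eq_mul₀ (norm_ne_zero_iff.mpr ha)] at h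
  have haη : a * η = ‖a‖ := by
    refine mul_left_cancel₀ hα ?_
    rw [mul_left_comm, ← hη, Complex.mul_conj', sq]
  have hbb : b * conj b = (‖b‖ : ℂ) ^ 2 := Complex.mul_conj' b
  refine ⟨η, -η * conj b / ‖b‖, -η * b / ‖b‖, hη_norm, by simp [hη_norm, hb],
    by simp [hη_norm, hb], fun s t => ?_⟩
  rw [hη]
  field_simp
  linear_combination (a * η ^ 2 * s * t - η * ‖b‖ * (s + t)) * hbb + η * s * t * ‖b‖ ^ 2 * haη

theorem norm_le_of_biaffine_growth {a b : ℂ} (ha : a ≠ 0)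
    (hgrowth : ∀ u v : ℂ, ‖u‖ = 1 → ‖v‖ = 1 → ∀ x y : ℝ, 1 ≤ x → 1 ≤ y →
      x * y * ‖a * (u * v) + b * u + conj b * v + conj a‖ ^ 2 ≤
        ‖a * (x * u * (y * v)) + b * (x * u) + conj b * (y * v) + conj a‖ ^ 2) :
    ‖b‖ ≤ ‖a‖ := by
  by_contra! hab
  have hα : 0 < ‖a‖ := norm_pos_iff.mpr ha
  have hβ : 0 < ‖b‖ := hα.trans hab
  obtain ⟨η, u, v, hη, hu, hv, hray⟩ := exists_biaffine_eq_norm ha (norm_pos_iff.mp hβ)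
  -- If `‖a‖ < ‖b‖`, the real polynomial on this ray has a zero `(x, y)` with `1 ≤ x, y`.
  obtain ⟨x, y, hx, hy, hzero⟩ : ∃ x y : ℝ, 1 ≤ x ∧ 1 ≤ y ∧
      ‖a‖ * (x * y) - ‖b‖ * (x + y) + ‖a‖ = 0 := by
    refine ⟨(2 * ‖b‖ ^ 2 - ‖a‖ ^ 2) / (‖a‖ * ‖b‖), 2 * ‖b‖ / ‖a‖, ?_, ?_, by field_simp; ring⟩
    · rw [le_div_iff₀ (by positivity)]
      nlinarith
    · rw [le_div_iff₀ hα]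
      linarith
  have hone := hray 1 1
  simp only [one_mul, mul_one] at hone
  have h := hgrowth u v hu hv x y hx hy
  rw [hray, hone, norm_mul, norm_mul, hη, one_mul, one_mul] at h
  norm_cast at h
  rw [hzero, Real.norm_eq_abs, sq_abs] at h
  have hpos : 0 < x * y * (‖a‖ - ‖b‖ * (1 + 1) + ‖a‖) ^ 2 :=
    mul_pos (mul_pos (by linarith) (by linarith)) (sq_pos_of_neg (by linarith))
  simp only [Nat.reduceAdd, Nat.cast_ofNat, norm_zero, ne_eq, OfNat.ofNat_ne_zero,
    not_false_eq_true, zero_pow] at h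
  linarith

theorem IsLosslessResolvent.neg_mul_nonneg_of_det_ne_zero {T : Matrix (Fin 2) (Fin 2) ℂ}
    (hT : IsLosslessResolvent T) (hdet : T.det ≠ 0) : 0 ≤ -(T 0 1 * T 1 0) := by
  have hsign : ∀ u v : ℂ, ‖u‖ = 1 → ‖v‖ = 1 →
      perturbationDet T ![u, v] = u * v * conj (perturbationDet T ![u, v]) :=
    fun u v hu hv => by simpa using hT.eq_conj ![u, v] (by simp [Fin.forall_fin_two, hu, hv])
  have h11 := hsign 1 1 (by simp) (by simp)
  have h12 := hsign 1 (-1) (by simp) (by simp)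
  have h21 := hsign (-1) 1 (by simp) (by simp)
  have h22 := hsign (-1) (-1) (by simp) (by simp)
  simp only [perturbationDet_fin_two, map_add, map_sub, map_mul, map_neg,
    map_one] at h11 h12 h21 h22
  have hd : conj T.det = 1 - T 0 0 - T 1 1 + T.det := by
    linear_combination -(h11 + h22 + h12 + h21) / 4
  have hc : conj (T 0 0 - T.det) = T 1 1 - T.det := by
    simp only [map_sub]
    linear_combination -(h11 - h22 + h21 - h12) / 4
  have hle := norm_le_of_biaffine_growth (b := T 0 0 - T.det) hdet fun u v hu hv x y hx hy => by
    rw [hc, hd]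
    have hmul : (fun k => (![x, y] k : ℂ) * ![u, v] k) = ![x * u, y * v] := by
      funext k
      fin_cases k <;> rfl
    have h := hT.prod_mul_norm_sq_le ![u, v] (by simp [Fin.forall_fin_two, hu, hv]) ![x, y]
      (by simp [Fin.forall_fin_two, hx, hy])
    simpa [hmul, perturbationDet_fin_two] using h
  have hval : -(T 0 1 * T 1 0) = ((‖T.det‖ ^ 2 - ‖T 0 0 - T.det‖ ^ 2 : ℝ) : ℂ) := by
    push_cast
    rw [← Complex.mul_conj', ← Complex.mul_conj', hc, hd, det_fin_two]
    ring
  rw [hval, Complex.zero_le_real, sub_nonneg]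
  gcongr

theorem det_submatrix_mul_det_diagonal_sub {κ : Type*} [Fintype κ] [DecidableEq κ]
    {A T : Matrix ι ι ℂ} {w : ι → ℂ} (hT : T * (diagonal w - A) = diagonal w) {e : κ → ι}
    (he : Function.Injective e) :
    (T.submatrix e e).det * (diagonal w - A).det =
      (diagonal w - (1 - diagonal (Function.extend e 1 0)) * A).det := by
  have hsub : 1 + diagonal 1 * (T - 1).submatrix e e = T.submatrix e e := by
    have hone : diagonal (1 : κ → ℂ) = 1 := diagonal_one
    rw [hone, one_mul, submatrix_sub, Pi.sub_apply, Pi.sub_apply, submatrix_one e he,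
      add_sub_cancel]
  rw [← hsub, ← det_one_add_diagonal_extend_mul he, ← det_mul, add_mul, one_mul, Matrix.mul_assoc,
    sub_mul T, hT, one_mul, sub_sub_cancel, sub_mul, one_mul, sub_sub_eq_add_sub,
    sub_add_eq_add_sub]

theorem frequently_eval_ne_zero {p : ℂ[X]} (hp : p ≠ 0) :
    ∃ᶠ ζ in 𝓝 (1 : ℂ), ‖ζ‖ = 1 ∧ p.eval ζ ≠ 0 := by
  have hderiv : HasDerivAt (fun t : ℝ => Complex.exp (t * Complex.I)) Complex.I 0 := by
    simpa using ((Complex.ofRealCLM.hasDerivAt (x := (0 : ℝ))).mul_const Complex.I).cexp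
  have htend := hderiv.tendsto_nhdsNE Complex.I_ne_zero
  rw [Complex.ofReal_zero, zero_mul, Complex.exp_zero] at htend
  have hroots : ∀ᶠ ζ in 𝓝[≠] (1 : ℂ), p.eval ζ ≠ 0 :=
    nhdsNE_le_cofinite 1 (finite_setOfPred_isRoot hp).compl_mem_cofinite
  refine (htend.mono_right nhdsWithin_le_nhds).frequently (Eventually.frequently ?_)
  filter_upwards [htend.eventually hroots] with t ht
  exact ⟨Complex.norm_exp_ofReal_mul_I t, ht⟩

theorem det_diagonal_smul_sub {w : ι → ℂ} (hw : ∀ k, ‖w k‖ = 1) (B : Matrix ι ι ℂ) (ζ : ℂ) :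
    (diagonal (ζ • w) - B).det =
      (diagonal w).det * ((diagonal w)⁻¹ * B).charpoly.eval ζ := by
  rw [eval_charpoly, ← det_mul, mul_sub, mul_nonsing_inv_cancel_left _ _
    (det_diagonal_ne_zero hw).isUnit, scalar_apply, diagonal_mul_diagonal]
  simp only [Pi.smul_def, smul_eq_mul, mul_comm]

theorem mem_closure_torusResolvents_det_submatrix_ne_zero {κ : Type*} [Fintype κ] [DecidableEq κ]
    {A T : Matrix ι ι ℂ} (hT : T ∈ torusResolvents A) {e : κ → ι} (he : Function.Injective e) :
    T ∈ closure {T' ∈ torusResolvents A | (T'.submatrix e e).det ≠ 0} := by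
  obtain ⟨w, hw, hT⟩ := hT
  have hunit := (det_diagonal_sub_ne_zero hw hT).isUnit
  let B := (1 - diagonal (Function.extend e 1 0)) * A
  have hp := mul_ne_zero ((diagonal w)⁻¹ * A).charpoly_monic.ne_zero
    ((diagonal w)⁻¹ * B).charpoly_monic.ne_zero
  have hlim : Tendsto (fun ζ : ℂ => diagonal (ζ • w) * (diagonal (ζ • w) - A)⁻¹) (𝓝 1) (𝓝 T) := by
    have hval : T = diagonal ((1 : ℂ) • w) * (diagonal ((1 : ℂ) • w) - A)⁻¹ := by
      rw [one_smul]
      nth_rw 1 [← hT]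
      exact (mul_nonsing_inv_cancel_right _ _ hunit).symm
    have hinv : ContinuousAt (fun ζ : ℂ => (diagonal (ζ • w) - A)⁻¹) 1 :=
      ContinuousAt.comp (continuousAt_matrix_inv _ (by simpa using hunit)) (by fun_prop)
    rw [hval]
    exact ContinuousAt.mul (by fun_prop) hinv
  refine mem_closure_of_frequently_of_tendsto ((frequently_eval_ne_zero hp).mono ?_) hlim
  rintro ζ ⟨hζ, heval⟩
  rw [eval_mul] at heval
  have hζw : ∀ k, ‖(ζ • w) k‖ = 1 := by simp [hζ, hw]
  have hdet : (diagonal (ζ • w) - A).det ≠ 0 := by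
    rw [det_diagonal_smul_sub hw]
    exact mul_ne_zero (det_diagonal_ne_zero hw) (left_ne_zero_of_mul heval)
  refine ⟨diagonal_mul_inv_mem_torusResolvents hζw hdet,
    left_ne_zero_of_mul (b := (diagonal (ζ • w) - A).det) ?_⟩
  rw [det_submatrix_mul_det_diagonal_sub (nonsing_inv_mul_cancel_right _ _ hdet.isUnit) he,
    det_diagonal_smul_sub hw]
  exact mul_ne_zero (det_diagonal_ne_zero hw) (right_ne_zero_of_mul heval)

theorem IsUnilossless.neg_mul_nonneg {A T : Matrix ι ι ℂ} (hA : IsUnilossless A)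
    (hT : T ∈ torusResolvents A) {i j : ι} (hij : i ≠ j) : 0 ≤ -(T i j * T j i) := by
  have he : Function.Injective ![i, j] := by
    simpa [Function.Injective, Fin.forall_fin_two, eq_comm] using hij
  have hclosed : IsClosed {T : Matrix ι ι ℂ | 0 ≤ -(T i j * T j i)} :=
    isClosed_le continuous_const (by fun_prop)
  refine closure_minimal ?_ hclosed (mem_closure_torusResolvents_det_submatrix_ne_zero hT he)
  rintro T' ⟨hT', hdet⟩
  exact ((hA.isLosslessResolvent hT').submatrix he).neg_mul_nonneg_of_det_ne_zero hdet

theorem torusResolvents_nonempty (A : Matrix ι ι ℂ) : (torusResolvents A).Nonempty := by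
  have hw : ∀ k : ι, ‖(1 : ι → ℂ) k‖ = 1 := by simp
  obtain ⟨ζ, hζ, heval⟩ :=
    (frequently_eval_ne_zero ((diagonal 1)⁻¹ * A).charpoly_monic.ne_zero).exists
  exact ⟨_, diagonal_mul_inv_mem_torusResolvents (w := ζ • 1) (by simp [hζ]) <| by
    rw [det_diagonal_smul_sub hw]
    exact mul_ne_zero (det_diagonal_ne_zero hw) heval⟩

/-! ### Rank-one perturbations -/

theorem exists_norm_one_sub_one_mul_eq {t : ℂ} (ht : t + conj t = 1) (τ : ℝ) :
    ∃ u : ℂ, ‖u‖ = 1 ∧ (u - 1) * (1 + Complex.I * τ * t) = -(Complex.I * τ) := by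
  have hconj : conj (1 + Complex.I * τ * t) = 1 + Complex.I * τ * t - Complex.I * τ := by
    simp only [map_add, map_mul, map_one, Complex.conj_I, Complex.conj_ofReal]
    linear_combination -Complex.I * τ * ht
  have hne : 1 + Complex.I * τ * t ≠ 0 := by
    intro h0
    rw [h0, map_zero, zero_sub, eq_comm, neg_eq_zero] at hconj
    rw [hconj, zero_mul, add_zero] at h0
    exact one_ne_zero h0
  refine ⟨conj (1 + Complex.I * τ * t) / (1 + Complex.I * τ * t), ?_, ?_⟩
  · rw [norm_div, RCLike.norm_conj, div_self (norm_ne_zero_iff.mpr hne)]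
  · rw [sub_mul, div_mul_cancel₀ _ hne, hconj]
    ring

theorem mul_single_mul_apply {R : Type*} [Semiring R] (M N : Matrix ι ι R) (k i j : ι) :
    (M * single k k (1 : R) * N) i j = M i k * N k j := by
  rw [mul_apply, Finset.sum_eq_single k
    (fun l _ hl => by rw [mul_single_apply_of_ne _ _ _ _ _ hl, zero_mul]) (by simp),
    mul_single_apply_same, mul_one]

-- Rotating the `k`-th entry of `W` changes `T` by a matrix of rank one.
theorem add_smul_mem_torusResolvents {A T : Matrix ι ι ℂ} (hT : T ∈ torusResolvents A) {k : ι}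
    (hk : T k k + conj (T k k) = 1) (τ : ℝ) :
    T + (Complex.I * τ) • ((T - 1) * single k k 1 * T) ∈ torusResolvents A := by
  obtain ⟨w, hw, hT⟩ := hT
  obtain ⟨u, hu, huτ⟩ := exists_norm_one_sub_one_mul_eq hk τ
  set S : Matrix ι ι ℂ := single k k 1
  have hSTS : S * T * S = T k k • S := by simp [S, single_mul_mul_single]
  have hW : diagonal (Function.update w k (u * w k)) = (1 + (u - 1) • S) * diagonal w := by
    ext i j
    rcases eq_or_ne i j with rfl | hij
    · rcases eq_or_ne i k with rfl | hik
      · simp [S]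
      · simp [S, hik, hik.symm]
    · have hS : S i j = 0 := single_apply_of_ne _ _ _ _ _ fun h => hij (h.1.symm.trans h.2)
      simp [hij, hS]
  refine ⟨Function.update w k (u * w k), fun i => ?_, ?_⟩
  · rcases eq_or_ne i k with rfl | hik <;> simp [*]
  have hsub : T * (diagonal (Function.update w k (u * w k)) - A) =
      (1 + (u - 1) • (T * S)) * diagonal w := by
    rw [hW, add_mul, one_mul, add_sub_right_comm, mul_add, hT, add_mul, one_mul]
    simp only [smul_mul_assoc, mul_smul_comm, mul_assoc]
  have hfactor : T + (Complex.I * τ) • ((T - 1) * S * T) =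
      (1 + (Complex.I * τ) • ((T - 1) * S)) * T := by
    rw [add_mul, one_mul, smul_mul_assoc]
  have hTSTS : T * S * (T * S) = T k k • (T * S) := by
    rw [mul_assoc T, ← mul_assoc S, hSTS, mul_smul_comm]
  have hSTS' : S * (T * S) = T k k • S := by rw [← mul_assoc, hSTS]
  rw [hfactor, mul_assoc, hsub, ← mul_assoc, hW]
  congr 1
  simp only [add_mul, mul_add, one_mul, mul_one, sub_mul, smul_mul_assoc, mul_smul_comm, hTSTS,
    hSTS']
  match_scalars
  · ring
  · linear_combination huτ
  · linear_combination -huτ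

theorem im_eq_zero_and_discrim_nonpos_of_forall_nonneg {a b c : ℂ}
    (h : ∀ t : ℝ, 0 ≤ a * (t * t) + b * t + c) : b.im = 0 ∧ discrim a b c ≤ 0 := by
  have h0 := (Complex.nonneg_iff.mp (h 0)).2
  have h1 := (Complex.nonneg_iff.mp (h 1)).2
  have h2 := (Complex.nonneg_iff.mp (h (-1))).2
  simp only [Complex.ofReal_zero, mul_zero, add_zero, zero_add, Complex.ofReal_one, mul_one,
    Complex.add_im, Complex.ofReal_neg, mul_neg, neg_neg, Complex.neg_im] at h0 h1 h2
  have hb : b.im = 0 := by linarith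
  have ha : a.im = 0 := by linarith
  lift a to ℝ using ha
  lift b to ℝ using hb
  lift c to ℝ using h0.symm
  refine ⟨Complex.ofReal_im b, ?_⟩
  have hdiscrim : discrim (a : ℂ) b c = (discrim a b c : ℝ) := by simp [discrim]
  rw [hdiscrim, ← Complex.ofReal_zero, Complex.real_le_real]
  exact discrim_le_zero fun t => by exact_mod_cast h t

theorem mul_eq_neg_conj_of_forall_nonneg {p q r s : ℂ}
    (h : ∀ t : ℝ, 0 ≤ -((p + Complex.I * t * q) * (r + Complex.I * t * s))) :
    q * r = -conj (p * s) := by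
  obtain ⟨hb, hdiscrim⟩ := im_eq_zero_and_discrim_nonpos_of_forall_nonneg
    (a := q * s) (b := -Complex.I * (p * s + q * r)) (c := -(p * r)) fun t => by
      convert h t using 1
      linear_combination (t : ℂ) ^ 2 * q * s * Complex.I_sq
  have hsq : 0 ≤ (p * s - q * r) ^ 2 := by
    rw [← neg_nonneg] at hdiscrim
    convert hdiscrim using 1
    rw [discrim]
    linear_combination (p * s + q * r) ^ 2 * Complex.I_sq
  have hsub := Complex.conj_eq_iff_im.mpr (Complex.sq_nonneg_iff.mp hsq)
  have hadd := Complex.conj_eq_iff_im.mpr hb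
  rw [map_mul, map_neg, Complex.conj_I, map_add] at hadd
  rw [map_sub] at hsub
  linear_combination (hsub - Complex.I * hadd) / 2 +
    (conj (p * s) + conj (q * r) + p * s + q * r) / 2 * Complex.I_sq

theorem IsUnilossless.add_smul_mem_torusResolvents {A T : Matrix ι ι ℂ} (hA : IsUnilossless A)
    (hT : T ∈ torusResolvents A) (k : ι) (τ : ℝ) :
    T + (Complex.I * τ) • ((T - 1) * single k k 1 * T) ∈ torusResolvents A :=
  FDN.add_smul_mem_torusResolvents hT ((hA.isLosslessResolvent hT).apply_add_conj k) τ

theorem IsUnilossless.cycle_eq_neg_conj {A T : Matrix ι ι ℂ} (hA : IsUnilossless A)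
    (hT : T ∈ torusResolvents A) {i j k : ι} (hij : i ≠ j) (hik : i ≠ k) (hjk : j ≠ k) :
    T i k * T k j * T j i = -conj (T i j * (T j k * T k i)) := by
  refine mul_eq_neg_conj_of_forall_nonneg fun τ => ?_
  have h := hA.neg_mul_nonneg (hA.add_smul_mem_torusResolvents hT k τ) hij
  simpa [mul_single_mul_apply, one_apply, hik, hjk] using h

/-! ### Irreducible matrices and supports -/

theorem isReducible_iff_exists_set {κ : Type*} [Finite κ] (A : Matrix κ κ ℂ) :
    IsReducible A ↔ ∃ s : Set κ, s.Nonempty ∧ sᶜ.Nonempty ∧ ∀ i ∈ s, ∀ j ∉ s, A i j = 0 := by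
  classical
  have := Fintype.ofFinite κ
  constructor
  · rintro ⟨p, q, σ, E, G, F, hp, hq, hA⟩
    refine ⟨Set.range (σ ∘ Sum.inr), ⟨_, ⟨0, hq⟩, rfl⟩, ⟨σ (Sum.inl ⟨0, hp⟩), ?_⟩, ?_⟩
    · rintro ⟨x, hx⟩
      simpa using σ.injective hx
    · rintro _ ⟨x, rfl⟩ j hj
      obtain ⟨y | y, rfl⟩ := σ.surjective j
      · simpa using congrFun (congrFun hA (Sum.inr x)) (Sum.inl y)
      · exact absurd ⟨y, rfl⟩ hj
  · rintro ⟨s, ⟨i, hi⟩, ⟨j, hj⟩, hA⟩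
    let e₁ := (Fintype.equivFin {x // x ∉ s}).symm
    let e₂ := (Fintype.equivFin {x // ¬ x ∉ s}).symm
    let σ := (Equiv.sumCongr e₁ e₂).trans (Equiv.sumCompl fun x => x ∉ s)
    refine ⟨_, _, σ, (A.submatrix σ σ).toBlocks₁₁, (A.submatrix σ σ).toBlocks₁₂,
      (A.submatrix σ σ).toBlocks₂₂, Fintype.card_pos_iff.mpr ⟨⟨j, hj⟩⟩,
      Fintype.card_pos_iff.mpr ⟨⟨i, not_not.mpr hi⟩⟩, ?_⟩
    rw [← fromBlocks_toBlocks (A.submatrix σ σ)]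
    congr 1
    ext x y
    exact hA _ (not_not.mp (e₂ x).2) _ (e₁ y).2

theorem exists_maximal_support {α β R : Type*} [Finite α] [Finite β] [Zero R]
    {S : Set (Matrix α β R)} (hS : S.Nonempty) :
    ∃ T ∈ S, ∀ T' ∈ S, (∀ i j, T i j ≠ 0 → T' i j ≠ 0) → ∀ i j, T' i j ≠ 0 → T i j ≠ 0 := by
  let supp : Matrix α β R → Set (α × β) := fun T => {ij | T ij.1 ij.2 ≠ 0}
  obtain ⟨T, hT, hmax⟩ := Set.Finite.exists_maximalFor' supp S (Set.toFinite _) hS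
  exact ⟨T, hT, fun T' hT' hle i j hij =>
    hmax hT' (fun ij => hle ij.1 ij.2) (a := (i, j)) hij⟩

theorem IsUnilossless.apply_ne_zero_trans_of_maximal {A T : Matrix ι ι ℂ} (hA : IsUnilossless A)
    (hT : T ∈ torusResolvents A)
    (hmax : ∀ T' ∈ torusResolvents A, (∀ i j, T i j ≠ 0 → T' i j ≠ 0) →
      ∀ i j, T' i j ≠ 0 → T i j ≠ 0)
    {i j k : ι} (hik : T i k ≠ 0) (hkj : T k j ≠ 0) : T i j ≠ 0 := by
  rcases eq_or_ne i k with rfl | hne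
  · exact hkj
  intro hij
  let T' : ℝ → Matrix ι ι ℂ := fun τ => T + (Complex.I * τ) • ((T - 1) * single k k (1 : ℂ) * T)
  have hcont : Continuous T' := by fun_prop
  have hlim : Tendsto T' (𝓝[≠] 0) (𝓝 T) := by
    simpa [T'] using (hcont.tendsto 0).mono_left nhdsWithin_le_nhds
  have hsupp : ∀ᶠ τ in 𝓝[≠] 0, ∀ a b, T a b ≠ 0 → T' τ a b ≠ 0 := by
    refine eventually_all.mpr fun a => eventually_all.mpr fun b => ?_
    have hab : Tendsto (fun τ => T' τ a b) (𝓝[≠] 0) (𝓝 (T a b)) :=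
      tendsto_pi_nhds.mp (tendsto_pi_nhds.mp hlim a) b
    by_cases h : T a b = 0
    · simp [h]
    · exact (hab.eventually_ne h).mono fun _ hτ _ => hτ
  obtain ⟨τ, hτ, hτ0⟩ := (hsupp.and self_mem_nhdsWithin).exists
  refine hmax (T' τ) (hA.add_smul_mem_torusResolvents hT k τ) hτ i j ?_ hij
  simpa [T', mul_single_mul_apply, hij, hne, hik, hkj] using hτ0

theorem IsUnilossless.exists_mem_torusResolvents_forall_ne_zero {A : Matrix ι ι ℂ}
    (hA : IsUnilossless A) (hirr : ¬ IsReducible A) :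
    ∃ T ∈ torusResolvents A, ∀ i j, T i j ≠ 0 := by
  classical
  obtain ⟨T, hT, hmax⟩ := exists_maximal_support (torusResolvents_nonempty A)
  refine ⟨T, hT, fun i j hij => hirr ((isReducible_iff_exists_set A).mpr ?_)⟩
  have hdiag : T i i ≠ 0 := by
    intro h
    simpa [h] using (hA.isLosslessResolvent hT).apply_add_conj i
  refine ⟨{k | T i k ≠ 0}, ⟨i, hdiag⟩, ⟨j, not_not.mpr hij⟩, fun k hk l hl => ?_⟩
  have htrans : ∀ {k l}, T i k ≠ 0 → T i l = 0 → T k l = 0 := fun hk hl => by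
    contrapose! hl
    exact hA.apply_ne_zero_trans_of_maximal hT hmax hk hl
  have htri : T.BlockTriangular fun k => T i k ≠ 0 := by
    intro k l hlk
    obtain ⟨hk, hl⟩ := Classical.not_imp.mp hlk.not_ge
    exact htrans hk (not_not.mp hl)
  obtain ⟨w, hw, hTw⟩ := hT
  have hunit := isUnit_of_mem_torusResolvents ⟨w, hw, hTw⟩
  have := hunit.invertible
  have hinv := blockTriangular_inv_of_blockTriangular htri
  have hA_eq : A = diagonal w - T⁻¹ * diagonal w := by
    rw [← hTw, nonsing_inv_mul_cancel_left _ _ ((isUnit_iff_isUnit_det T).mp hunit), hTw]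
    abel
  have hAtri : A.BlockTriangular fun k => T i k ≠ 0 := by
    rw [hA_eq]
    exact (blockTriangular_diagonal _).sub (hinv.mul (blockTriangular_diagonal _))
  exact hAtri (lt_of_le_not_ge (fun h => absurd h hl) fun h => hl (h hk))

/-! ### Existence of a diagonal invariant -/

theorem eq_neg_div_norm_mul_conj {x y : ℂ} (h : 0 ≤ -(x * y)) (hy : y ≠ 0) :
    x = -((‖x‖ / ‖y‖ : ℝ) * conj y) := by
  have hxy : -(x * y) = (‖x‖ : ℂ) * ‖y‖ := by
    simpa using Complex.eq_coe_norm_of_nonneg h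
  have hy' : (‖y‖ : ℂ) ≠ 0 := by simpa using hy
  refine mul_right_cancel₀ hy ?_
  rw [neg_mul, mul_assoc, Complex.conj_mul', ← neg_eq_iff_eq_neg, hxy]
  push_cast
  field_simp

theorem IsUnilossless.exists_pos_mul_eq_neg_mul_conj {A T : Matrix ι ι ℂ} (hA : IsUnilossless A)
    (hT : T ∈ torusResolvents A) (hne : ∀ i j, T i j ≠ 0) :
    ∃ e : ι → ℝ, (∀ i, 0 < e i) ∧ ∀ i j, i ≠ j → T i j * e j = -(e i * conj (T j i)) := by
  rcases isEmpty_or_nonempty ι with _ | ⟨⟨o⟩⟩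
  · exact ⟨1, fun _ => one_pos, isEmptyElim⟩
  let e : ι → ℝ := fun i => ‖T i o‖ / ‖T o i‖
  have he : ∀ i, 0 < e i := fun i =>
    div_pos (norm_pos_iff.mpr (hne i o)) (norm_pos_iff.mpr (hne o i))
  have heo : e o = 1 := div_self (norm_ne_zero_iff.mpr (hne o o))
  have hcol : ∀ i, i ≠ o → T i o = -(e i * conj (T o i)) := fun i hi =>
    eq_neg_div_norm_mul_conj (hA.neg_mul_nonneg hT hi) (hne o i)
  have hrow : ∀ i, i ≠ o → conj (T i o) = -(e i * T o i) := fun i hi => by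
    simpa using congrArg conj (hcol i hi)
  refine ⟨e, he, fun i j hij => ?_⟩
  rcases eq_or_ne j o with rfl | hj
  · simpa [heo] using hcol i hij
  rcases eq_or_ne i o with rfl | hi
  · rw [hrow j hj, heo]
    push_cast
    ring
  have hcycle := hA.cycle_eq_neg_conj hT hij.symm hj hi
  rw [map_mul, map_mul, hrow i hi, hcol j hj] at hcycle
  refine mul_right_cancel₀ (mul_ne_zero (hne o i) ((_root_.map_ne_zero conj).mpr (hne o j))) ?_
  linear_combination -hcycle

theorem IsUnilossless.exists_lyapunov {A T : Matrix ι ι ℂ} (hA : IsUnilossless A)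
    (hT : T ∈ torusResolvents A) (hne : ∀ i j, T i j ≠ 0) :
    ∃ e : ι → ℝ, (∀ i, 0 < e i) ∧
      T * diagonal (fun i => (e i : ℂ)) + diagonal (fun i => (e i : ℂ)) * Tᴴ =
        diagonal fun i => (e i : ℂ) := by
  obtain ⟨e, he, hskew⟩ := hA.exists_pos_mul_eq_neg_mul_conj hT hne
  refine ⟨e, he, ?_⟩
  ext i j
  rw [Matrix.add_apply, mul_diagonal, diagonal_mul, conjTranspose_apply]
  rcases eq_or_ne i j with rfl | hij
  · rw [diagonal_apply_eq, ← starRingEnd_apply]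
    linear_combination (e i : ℂ) * (hA.isLosslessResolvent hT).apply_add_conj i
  · rw [diagonal_apply_ne _ hij, hskew i j hij]
    exact neg_add_cancel _

theorem diagonal_mul_diagonal_mul_conjTranspose {w : ι → ℂ} (hw : ∀ k, ‖w k‖ = 1) (e : ι → ℂ) :
    diagonal w * diagonal e * (diagonal w)ᴴ = diagonal e := by
  rw [diagonal_conjTranspose, diagonal_mul_diagonal, diagonal_mul_diagonal]
  congr 1
  funext k
  have h : w k * star (w k) = 1 := (Complex.mul_conj' _).trans (by simp [hw])
  rw [Pi.star_apply]
  linear_combination e k * h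

theorem mul_diagonal_mul_conjTranspose_of_lyapunov {A T : Matrix ι ι ℂ}
    (hT : T ∈ torusResolvents A) {e : ι → ℂ}
    (h : T * diagonal e + diagonal e * Tᴴ = diagonal e) :
    A * diagonal e * Aᴴ = diagonal e := by
  have hunit := isUnit_of_mem_torusResolvents hT
  obtain ⟨w, hw, hT⟩ := hT
  have hTA : T * A = (T - 1) * diagonal w := by
    rw [mul_sub, sub_eq_iff_eq_add'] at hT
    rw [sub_mul, one_mul, hT, add_sub_cancel_right]
  refine hunit.mul_left_cancel ((isUnit_conjTranspose T).mpr hunit |>.mul_right_cancel ?_)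
  calc T * (A * diagonal e * Aᴴ) * Tᴴ
      = (T * A) * diagonal e * (T * A)ᴴ := by simp only [conjTranspose_mul, mul_assoc]
    _ = (T - 1) * (diagonal w * diagonal e * (diagonal w)ᴴ) * (T - 1)ᴴ := by
      simp only [hTA, conjTranspose_mul, mul_assoc]
    _ = T * diagonal e * Tᴴ + diagonal e - (T * diagonal e + diagonal e * Tᴴ) := by
      rw [diagonal_mul_diagonal_mul_conjTranspose hw, conjTranspose_sub, conjTranspose_one]
      noncomm_ring
    _ = T * diagonal e * Tᴴ := by rw [h, add_sub_cancel_right]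

theorem IsUnilossless.hasPositiveDiagonalInvariant {A : Matrix ι ι ℂ} (hA : IsUnilossless A)
    (hirr : ¬ IsReducible A) : HasPositiveDiagonalInvariant A := by
  obtain ⟨T, hT, hne⟩ := hA.exists_mem_torusResolvents_forall_ne_zero hirr
  obtain ⟨e, he, hTe⟩ := hA.exists_lyapunov hT hne
  exact ⟨e, he, mul_diagonal_mul_conjTranspose_of_lyapunov hT hTe⟩

/-! ### Block triangular forms -/

theorem genCharpoly_eq_prod_toSquareBlock {α : Type*} [Fintype α] [LinearOrder α] {A : Matrix ι ι ℂ}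
    {b : ι → α} (hb : A.BlockTriangular b) (m : ι → ℕ) :
    genCharpoly A m = ∏ c, genCharpoly (A.toSquareBlock b c) fun i => m i := by
  have htri : (diagonal (fun i => (X : ℂ[X]) ^ m i) - A.map C).BlockTriangular b :=
    (blockTriangular_diagonal _).sub fun i j hij => by simp [hb hij]
  rw [genCharpoly, htri.det_fintype]
  refine Finset.prod_congr rfl fun c _ => ?_
  rw [genCharpoly]
  congr 1
  ext1 i j
  simp [toSquareBlock_def, diagonal_apply, Subtype.ext_iff]

theorem isUnilossless_iff_forall_toSquareBlock {α : Type*} [Finite α] [LinearOrder α]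
    {A : Matrix ι ι ℂ} {b : ι → α} (hb : A.BlockTriangular b) :
    IsUnilossless A ↔ ∀ c, IsUnilossless (A.toSquareBlock b c) := by
  have := Fintype.ofFinite α
  refine ⟨fun hA c m hm z hz => ?_, fun h m hm z hz => ?_⟩
  · let m' : ι → ℕ := fun i => if h : b i = c then m ⟨i, h⟩ else 1
    have hm' : ∀ i, 1 ≤ m' i := fun i => by
      by_cases h : b i = c
      · simpa [m', h] using hm ⟨i, h⟩
      · simp [m', h]
    have hm'_eq : (fun i : {i // b i = c} => m' i) = m := by
      funext i
      simp [m', i.2]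
    refine hA m' hm' z ?_
    rw [genCharpoly_eq_prod_toSquareBlock hb, IsRoot.def, eval_prod]
    refine Finset.prod_eq_zero (Finset.mem_univ c) ?_
    rwa [hm'_eq]
  · rw [genCharpoly_eq_prod_toSquareBlock hb, IsRoot.def, eval_prod, Finset.prod_eq_zero_iff] at hz
    obtain ⟨c, -, hc⟩ := hz
    exact h c _ (fun i => hm i) z hc

theorem exists_surjective_fin_of_rel {α : Type*} [Finite α] (r : α → α → Prop) :
    ∃ (k : ℕ) (b : α → Fin k), Function.Surjective b ∧ (∀ i j, r i j → b i ≤ b j) ∧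
      ∀ i j, b i = b j → Relation.ReflTransGen r i j := by
  classical
  let _ : Preorder α :=
    { le := Relation.ReflTransGen r
      le_refl := fun _ => .refl
      le_trans := fun _ _ _ => .trans }
  let L := LinearExtension (Antisymmetrization α (· ≤ ·))
  have : Finite L := inferInstanceAs (Finite (Quotient _))
  let _ : Fintype L := Fintype.ofFinite L
  let f : L ≃o Fin (Fintype.card L) := (Fintype.orderIsoFinOfCardEq L rfl).symm
  let q : α → L := fun i => toLinearExtension (toAntisymmetrization (· ≤ ·) i)
  refine ⟨_, f ∘ q, f.surjective.comp Quotient.mk_surjective, fun i j hij => ?_, fun i j hij => ?_⟩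
  · have hle : i ≤ j := Relation.ReflTransGen.single hij
    exact f.monotone <| toLinearExtension.monotone <|
      toAntisymmetrization_le_toAntisymmetrization_iff.mpr hle
  · exact (Quotient.exact (f.injective hij)).1

theorem not_isReducible_toSquareBlock {κ α : Type*} [Finite κ] [PartialOrder α] {A : Matrix κ κ ℂ}
    {b : κ → α} (hb : ∀ i j, A i j ≠ 0 → b i ≤ b j)
    (hpath : ∀ i j, b i = b j → Relation.ReflTransGen (fun i j => A i j ≠ 0) i j) (c : α) :
    ¬ IsReducible (A.toSquareBlock b c) := by
  rw [isReducible_iff_exists_set]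
  rintro ⟨s, ⟨i, hi⟩, ⟨j, hj⟩, hs⟩
  have hle : ∀ {x y}, Relation.ReflTransGen (fun i j => A i j ≠ 0) x y → b x ≤ b y := fun h => by
    induction h with
    | refl => exact le_rfl
    | tail _ hxy ih => exact ih.trans (hb _ _ hxy)
  have hmem : ∀ a, Relation.ReflTransGen (fun i j => A i j ≠ 0) a j →
      ∀ ha : b a = c, ⟨a, ha⟩ ∈ s → j ∈ s := by
    intro a ha
    induction ha using Relation.ReflTransGen.head_induction_on with
    | refl => exact fun _ h => h
    | head hab hbj ih =>
      intro ha has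
      have hbc := le_antisymm ((hle hbj).trans_eq j.2) (ha ▸ hb _ _ hab)
      refine ih hbc ?_
      by_contra hbs
      exact hab (hs _ has _ hbs)
  exact hj (hmem i (hpath _ _ (i.2.trans j.2.symm)) i.2 hi)

theorem exists_isIrreducibleBlockForm {κ : Type*} [Finite κ] (A : Matrix κ κ ℂ) :
    ∃ (k : ℕ) (b : κ → Fin k), IsIrreducibleBlockForm A b := by
  obtain ⟨k, b, hsurj, hmono, hpath⟩ := exists_surjective_fin_of_rel fun i j => A i j ≠ 0
  refine ⟨k, b, hsurj, fun i j hij => ?_, not_isReducible_toSquareBlock hmono hpath⟩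
  by_contra h
  exact (hmono i j h).not_gt hij

/-! ### Consequences of a diagonal invariant -/

theorem eq_one_of_sum_mul_pow_eq_sum {κ : Type*} [Fintype κ] {c : κ → ℝ} (hc : ∀ i, 0 ≤ c i)
    {k : κ} (hk : 0 < c k) {n : κ → ℕ} (hn : ∀ i, n i ≠ 0) {r : ℝ} (hr : 0 ≤ r)
    (h : ∑ i, c i * r ^ n i = ∑ i, c i) : r = 1 := by
  rcases lt_trichotomy r 1 with hlt | rfl | hgt
  · refine absurd h (Finset.sum_lt_sum (fun i _ => ?_) ⟨k, Finset.mem_univ k, ?_⟩).ne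
    · exact mul_le_of_le_one_right (hc i) (pow_le_one₀ hr hlt.le)
    · exact mul_lt_of_lt_one_right hk (pow_lt_one₀ hr hlt (hn k))
  · rfl
  · refine absurd h (Finset.sum_lt_sum (fun i _ => ?_) ⟨k, Finset.mem_univ k, ?_⟩).ne'
    · exact le_mul_of_one_le_right (hc i) (one_le_pow₀ hgt.le)
    · exact lt_mul_of_one_lt_right hk (one_lt_pow₀ hgt (hn k))

theorem vecMul_diagonal_dotProduct_star (v : ι → ℂ) (e : ι → ℝ) :
    v ᵥ* diagonal (fun i => (e i : ℂ)) ⬝ᵥ star v = (∑ i, e i * ‖v i‖ ^ 2 : ℝ) := by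
  push_cast
  refine Finset.sum_congr rfl fun i _ => ?_
  rw [vecMul_diagonal, Pi.star_apply, ← Complex.mul_conj', starRingEnd_apply]
  ring

theorem sum_mul_norm_vecMul_sq {A : Matrix ι ι ℂ} {e : ι → ℝ}
    (hE : A * diagonal (fun i => (e i : ℂ)) * Aᴴ = diagonal fun i => (e i : ℂ)) (v : ι → ℂ) :
    ∑ i, e i * ‖(v ᵥ* A) i‖ ^ 2 = ∑ i, e i * ‖v i‖ ^ 2 := by
  apply Complex.ofReal_injective
  rw [← vecMul_diagonal_dotProduct_star, ← vecMul_diagonal_dotProduct_star, star_vecMul,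
    dotProduct_mulVec, vecMul_vecMul, vecMul_vecMul, ← mul_assoc, hE]

theorem HasPositiveDiagonalInvariant.isUnilossless {A : Matrix ι ι ℂ}
    (hA : HasPositiveDiagonalInvariant A) : IsUnilossless A := by
  obtain ⟨e, he, hE⟩ := hA
  intro m hm z hz
  rw [IsRoot.def, eval_genCharpoly] at hz
  obtain ⟨v, hv0, hv⟩ := exists_vecMul_eq_zero_iff.mpr hz
  rw [vecMul_sub, sub_eq_zero] at hv
  obtain ⟨k, hk⟩ := Function.ne_iff.mp hv0
  refine eq_one_of_sum_mul_pow_eq_sum (c := fun i => e i * ‖v i‖ ^ 2) (n := fun i => 2 * m i)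
    (fun i => mul_nonneg (he i).le (sq_nonneg _))
    (mul_pos (he k) (pow_pos (norm_pos_iff.mpr hk) 2))
    (fun i => mul_ne_zero two_ne_zero (Nat.one_le_iff_ne_zero.mp (hm i))) (norm_nonneg z) ?_
  calc ∑ i, e i * ‖v i‖ ^ 2 * ‖z‖ ^ (2 * m i)
      = ∑ i, e i * ‖(v ᵥ* diagonal fun i => z ^ m i) i‖ ^ 2 := by
        refine Finset.sum_congr rfl fun i _ => ?_
        rw [vecMul_diagonal, norm_mul, norm_pow]
        ring
    _ = ∑ i, e i * ‖v i‖ ^ 2 := by rw [hv, sum_mul_norm_vecMul_sq hE]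

theorem inv_mul_mul_mem_unitaryGroup_iff {R : Type*} [CommRing R] [StarRing R] {F : Matrix ι ι R}
    (hF : IsUnit F) (A : Matrix ι ι R) :
    F⁻¹ * A * F ∈ unitaryGroup ι R ↔ A * (F * Fᴴ) * Aᴴ = F * Fᴴ := by
  have hF' : IsUnit Fᴴ := (isUnit_conjTranspose F).mpr hF
  have hconj : F * ((F⁻¹ * A * F) * (F⁻¹ * A * F)ᴴ) * Fᴴ = A * (F * Fᴴ) * Aᴴ := by
    rw [conjTranspose_mul, conjTranspose_mul, conjTranspose_nonsing_inv]
    simp only [mul_assoc, nonsing_inv_mul _ ((isUnit_iff_isUnit_det _).mp hF'), mul_one]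
    rw [mul_nonsing_inv_cancel_left _ _ ((isUnit_iff_isUnit_det _).mp hF)]
  rw [mem_unitaryGroup_iff, star_eq_conjTranspose, ← hconj]
  exact ⟨fun h => by rw [h, mul_one],
    fun h => hF.mul_left_cancel (hF'.mul_right_cancel (by rw [h, mul_one]))⟩

theorem inv_diagonal_mul_mul_mem_unitaryGroup_iff {f : ι → ℂ} (hf : ∀ i, f i ≠ 0)
    (A : Matrix ι ι ℂ) :
    (diagonal f)⁻¹ * A * diagonal f ∈ unitaryGroup ι ℂ ↔
      A * diagonal (fun i => ((‖f i‖ ^ 2 : ℝ) : ℂ)) * Aᴴ =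
        diagonal fun i => ((‖f i‖ ^ 2 : ℝ) : ℂ) := by
  have hF : IsUnit (diagonal f) := isUnit_diagonal.mpr <| Pi.isUnit_iff.mpr fun i => (hf i).isUnit
  have hnorm : diagonal (fun i => ((‖f i‖ ^ 2 : ℝ) : ℂ)) = diagonal f * (diagonal f)ᴴ := by
    rw [diagonal_conjTranspose, diagonal_mul_diagonal]
    congr 1
    funext i
    rw [Complex.ofReal_pow]
    exact (Complex.mul_conj' (f i)).symm
  rw [inv_mul_mul_mem_unitaryGroup_iff hF, hnorm]

theorem hasPositiveDiagonalInvariant_iff_isDiagonallySimilarToUnitary (A : Matrix ι ι ℂ) :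
    HasPositiveDiagonalInvariant A ↔ IsDiagonallySimilarToUnitary A := by
  constructor
  · rintro ⟨e, he, hE⟩
    have hf : ∀ i, ((√(e i) : ℝ) : ℂ) ≠ 0 := fun i =>
      Complex.ofReal_ne_zero.mpr (Real.sqrt_pos.mpr (he i)).ne'
    refine ⟨fun i => (√(e i) : ℝ), hf, (inv_diagonal_mul_mul_mem_unitaryGroup_iff hf A).mpr ?_⟩
    simpa only [Complex.norm_real, Real.norm_eq_abs, sq_abs, Real.sq_sqrt (he _).le] using hE
  · rintro ⟨f, hf, hU⟩
    exact ⟨fun i => ‖f i‖ ^ 2, fun i => pow_pos (norm_pos_iff.mpr (hf i)) 2,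
      (inv_diagonal_mul_mul_mem_unitaryGroup_iff hf A).mp hU⟩

end FDN

theorem theorem1_general {ι : Type*} [Fintype ι] [DecidableEq ι] (A : Matrix ι ι ℂ) :
    (FDN.IsUnilossless A ↔
      (FDN.IsReducible A ∧ FDN.AllComponentsUnilossless A) ∨
        FDN.HasPositiveDiagonalInvariant A) ∧
    (FDN.HasPositiveDiagonalInvariant A ↔ FDN.IsDiagonallySimilarToUnitary A) := by
  refine ⟨⟨fun hA => ?_, ?_⟩,
    FDN.hasPositiveDiagonalInvariant_iff_isDiagonallySimilarToUnitary A⟩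
  · by_cases hred : FDN.IsReducible A
    · exact Or.inl ⟨hred, fun _ _ hb =>
        (FDN.isUnilossless_iff_forall_toSquareBlock hb.blockTriangular).mp hA⟩
    · exact Or.inr (hA.hasPositiveDiagonalInvariant hred)
  · rintro (⟨-, hcomp⟩ | hinv)
    · obtain ⟨k, b, hb⟩ := FDN.exists_isIrreducibleBlockForm A
      exact (FDN.isUnilossless_iff_forall_toSquareBlock hb.blockTriangular).mpr (hcomp k b hb)
    · exact hinv.isUnilossless

theorem theorem1 (N : ℕ) (A : Matrix (Fin N) (Fin N) ℂ) :
    (FDN.IsUnilossless A ↔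
      (FDN.IsReducible A ∧ FDN.AllComponentsUnilossless A) ∨
        FDN.HasPositiveDiagonalInvariant A) ∧
    (FDN.HasPositiveDiagonalInvariant A ↔ FDN.IsDiagonallySimilarToUnitary A) :=
  theorem1_general A
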